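/- Let $\Gamma$ be a countable group with identity $e$, equipped with a left-invariant distance $d$ that is proper (all balls are finite), and write $|g| = d(g,e)$. Let $\mu$ be a probability measure on $\Gamma$ that is symmetric, i.e. $\mu(g^{-1}) = \mu(g)$ for all $g$, and has finite entropy $-\sum_g \mu(g)\log\mu(g) < \infty$. Let $\mu^{*n}$ denote the $n$-fold convolution of $\mu$, and let $$\rho = \limsup_{n\to\infty} \big(\mu^{*n}(e)\big)^{1/n}, \qquad h = \lim_{n\to\infty} -\frac1n \sum_{g\in\Gamma} \mu^{*n}(g)\log \mu^{*n}(g)$$ be the spectral radius and the asymptotic entropy of the random walk. Then every $\mu^{*n}$ has finite entropy, the limit defining $h$ exists and is finite, $0<\rho\le 1$, and $$2\sqrt{1-\rho^2}\,\operatorname{artanh}\sqrt{1-\rho^2} \;\le\; h.$$ If moreover $\mu$ has finite second moment, i.e. $M_2(\mu) = \big(\sum_g |g|^2\mu(g)\big)^{1/2} < \infty$, then every $\mu^{*n}$ has finite first moment, the limit $$\ell = \lim_{n\to\infty} \frac1n \sum_{g\in\Gamma} |g|\,\mu^{*n}(g)$$ (the drift) exists and is finite, and $\tilde\ell = \ell/M_2(\mu)$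 (read as $0$ if $M_2(\mu)=0$, i.e. if $\mu=\delta_e$) satisfies $0\le\tilde\ell<1$ and $$2\,\tilde\ell\,\operatorname{artanh}\tilde\ell \;\le\; h.$$ -/

import Mathlib

noncomputable section

namespace GroupWalk

/-- The convolution `μ * ν` of two probability measures on a group: the law of `a * b`, where
`a` and `b` are independent with laws `μ` and `ν`. -/
def conv {Γ : Type*} [Group Γ] (μ ν : PMF Γ) : PMF Γ :=
  μ.bind fun a => ν.map fun b => a * b

/-- The `n`-fold convolution `μ^{*n}`, the law of `X_n = γ₁ ⋯ γ_n`. -/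
def convPow {Γ : Type*} [Group Γ] (μ : PMF Γ) : ℕ → PMF Γ
  | 0 => PMF.pure 1
  | n + 1 => conv (convPow μ n) μ

/-- The measure `μ` is symmetric: `μ(g⁻¹) = μ(g)`. -/
def IsSymmetric {Γ : Type*} [Group Γ] (μ : PMF Γ) : Prop :=
  ∀ g : Γ, μ g⁻¹ = μ g

/-- The series of nonnegative terms `-∑ μ(g) log μ(g)` converges. -/
def FiniteEntropy {Γ : Type*} (μ : PMF Γ) : Prop :=
  Summable fun g : Γ => -((μ g).toReal * Real.log (μ g).toReal)

/-- The entropy `H(μ) = -∑ μ(g) log μ(g)`. -/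
def entropy {Γ : Type*} (μ : PMF Γ) : ℝ :=
  ∑' g : Γ, -((μ g).toReal * Real.log (μ g).toReal)

/-- The asymptotic entropy `h = lim_n H(μ^{*n}) / n`. -/
def asymptoticEntropy {Γ : Type*} [Group Γ] (μ : PMF Γ) : ℝ :=
  Filter.limUnder Filter.atTop fun n : ℕ => entropy (convPow μ n) / n

/-- The spectral radius `ρ = limsup_n μ^{*n}(e)^{1/n}`. -/
def spectralRad {Γ : Type*} [Group Γ] (μ : PMF Γ) : ℝ :=
  Filter.limsup (fun n : ℕ => (convPow μ n 1).toReal ^ (1 / (n : ℝ))) Filter.atTop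

/-- The distance is invariant under left translations. -/
def LeftInvariantDist (Γ : Type*) [Group Γ] [MetricSpace Γ] : Prop :=
  ∀ g x y : Γ, dist (g * x) (g * y) = dist x y

/-- The distance is proper: balls are finite. -/
def ProperDist (Γ : Type*) [MetricSpace Γ] : Prop :=
  ∀ (x : Γ) (r : ℝ), (Metric.closedBall x r).Finite

/-- The length `|g| = dist(g, e)`. -/
def len {Γ : Type*} [Group Γ] [MetricSpace Γ] (g : Γ) : ℝ := dist g 1

/-- `∑ |g| μ(g)` converges. -/
def FiniteFirstMoment {Γ : Type*} [Group Γ] [MetricSpace Γ] (μ : PMF Γ) : Prop :=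
  Summable fun g : Γ => len g * (μ g).toReal

/-- `∑ |g|² μ(g)` converges. -/
def FiniteSecondMoment {Γ : Type*} [Group Γ] [MetricSpace Γ] (μ : PMF Γ) : Prop :=
  Summable fun g : Γ => len g ^ 2 * (μ g).toReal

/-- The mean length `∑ |g| μ(g)`. -/
def meanLength {Γ : Type*} [Group Γ] [MetricSpace Γ] (μ : PMF Γ) : ℝ :=
  ∑' g : Γ, len g * (μ g).toReal

/-- `M₂(μ) = (∑ |g|² μ(g))^{1/2}`. -/
def M2 {Γ : Type*} [Group Γ] [MetricSpace Γ] (μ : PMF Γ) : ℝ :=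
  Real.sqrt (∑' g : Γ, len g ^ 2 * (μ g).toReal)

/-- The drift `ℓ = lim_n (1/n) ∑ |g| μ^{*n}(g)`. -/
def drift {Γ : Type*} [Group Γ] [MetricSpace Γ] (μ : PMF Γ) : ℝ :=
  Filter.limUnder Filter.atTop fun n : ℕ => meanLength (convPow μ n) / n

/-- The normalized drift `ℓ / M₂(μ)`. If `M₂(μ) = 0`, then `μ` is the point mass at the
identity, and the value is `0`. -/
def normDrift {Γ : Type*} [Group Γ] [MetricSpace Γ] (μ : PMF Γ) : ℝ :=
  drift μ / M2 μ

end GroupWalk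

end

/-
For `0 < p < 1` let `ν = ∑ₙ p (1 - p)ⁿ μ^{*n}`, so that `ν = p δ_e + (1 - p) ν * μ`. This resolvent
identity bounds the entropy production
`∑ μ(g) (ν(x) - ν(x g)) (log ν(x) - log ν(x g))` by `2 p / (1 - p) H(ν)`, which tends to `2 h` as
`p → 0`. Where `ν(x g) = e^{2 s} ν(x)`, the production, the mean `(ν(x) + ν(x g)) / 2` and the
affinity `√(ν(x) ν(x g))` are in the ratios `4 s sinh s : cosh s : 1`; since `s sinh s` is a convex
function of `cosh s`, the production is bounded below in terms of the total affinity
`Q = ∑ μ(g) √(ν(x) ν(x g))`. If `y² + Q² ≤ 1` for all `p`, this yields `2 y artanh y ≤ h`.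

Now `Q ≤ ρ`, because `√ν` is a unit vector of `ℓ²(Γ)`, on which convolution by `μ` has norm at most
`ρ`; and `ℓ̃² + Q² ≤ 1`, by testing the resolvent identity against the length. As `Q > 0`, the
latter also shows that `ℓ̃ < 1`.
-/

noncomputable section

namespace GroupWalk

open scoped ENNReal

section HyperbolicInequalities

open Real

lemma monotoneOn_mul_cosh_div_sinh :
    MonotoneOn (fun s : ℝ => s * cosh s / sinh s) (Set.Ioi 0) := by
  have hderiv : ∀ s ∈ Set.Ioi (0 : ℝ), HasDerivAt (fun s : ℝ => s * cosh s / sinh s)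
      (((1 * cosh s + s * sinh s) * sinh s - s * cosh s * cosh s) / sinh s ^ 2) s := fun s hs =>
    ((hasDerivAt_id' s).mul (hasDerivAt_cosh s)).div (hasDerivAt_sinh s) (sinh_pos_iff.2 hs).ne'
  refine monotoneOn_of_deriv_nonneg (convex_Ioi 0)
    (fun s hs => (hderiv s hs).continuousAt.continuousWithinAt) ?_ ?_ <;> rw [interior_Ioi]
  · exact fun s hs => (hderiv s hs).differentiableAt.differentiableWithinAt
  · intro s (hs : 0 < s)
    rw [(hderiv s hs).deriv]
    have hsinh : s ≤ sinh s := self_le_sinh_iff.2 hs.le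
    have hnum : s ≤ sinh s * cosh s := by nlinarith [one_le_cosh s]
    exact div_nonneg (by nlinarith [cosh_sq s]) (sq_nonneg _)

/-- `s sinh s` is a convex function of `cosh s`; this is its tangent line at `cosh s₀`. -/
lemma tangent_le_mul_sinh {s₀ : ℝ} (hs₀ : 0 < s₀) (s : ℝ) :
    s₀ * sinh s₀ + (1 + s₀ * cosh s₀ / sinh s₀) * (cosh s - cosh s₀) ≤ s * sinh s := by
  wlog hs : 0 ≤ s generalizing s
  · simpa using this (-s) (by linarith)
  set m := s₀ * cosh s₀ / sinh s₀
  let f : ℝ → ℝ := fun s => s * sinh s - (1 + m) * cosh s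
  have hf (s : ℝ) : HasDerivAt f (s * cosh s - m * sinh s) s :=
    (((hasDerivAt_id' s).mul (hasDerivAt_sinh s)).sub
      ((hasDerivAt_cosh s).const_mul _)).congr_deriv (by ring)
  have hdiff : Differentiable ℝ f := fun s => (hf s).differentiableAt
  have hmin : IsMinOn f (Set.Ici 0) s₀ := by
    refine isMinOn_Ici_of_deriv hdiff.continuous.continuousAt hdiff.continuous.continuousAt
      hdiff.differentiableOn hdiff.differentiableOn (fun s hs => ?_) fun s hs => ?_ <;>
      rw [(hf s).deriv]
    · have : s * cosh s / sinh s ≤ m := monotoneOn_mul_cosh_div_sinh hs.1 hs₀ hs.2.le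
      rw [div_le_iff₀ (sinh_pos_iff.2 hs.1)] at this
      linarith
    · have hs' : 0 < s := hs₀.trans hs
      have : m ≤ s * cosh s / sinh s := monotoneOn_mul_cosh_div_sinh hs₀ hs' (le_of_lt hs)
      rw [le_div_iff₀ (sinh_pos_iff.2 hs')] at this
      linarith
  have : f s₀ ≤ f s := hmin hs
  simp only [f] at this
  linarith

lemma exists_eq_sqrt_mul_exp {A B : ℝ} (hA : 0 < A) (hB : 0 < B) :
    ∃ s, A = √(A * B) * exp s ∧ B = √(A * B) * exp (-s) := by
  obtain ⟨a, rfl⟩ : ∃ a, exp a = A := ⟨log A, exp_log hA⟩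
  obtain ⟨b, rfl⟩ : ∃ b, exp b = B := ⟨log B, exp_log hB⟩
  rw [← exp_add, ← exp_half]
  exact ⟨(a - b) / 2, by rw [← exp_add]; ring_nf, by rw [← exp_add]; ring_nf⟩

lemma add_sub_sqrt_le_sub_mul_log_sub_log {A B s : ℝ} (hA : 0 < A) (hB : 0 < B) (hs : 0 < s) :
    2 * (1 + s * cosh s / sinh s) * (A + B) - 4 * (cosh s + s / sinh s) * √(A * B) ≤
      (A - B) * (log A - log B) := by
  have hu : 0 < √(A * B) := by positivity
  obtain ⟨t, hAt, hBt⟩ := exists_eq_sqrt_mul_exp hA hB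
  set u := √(A * B)
  have hadd : A + B = 2 * u * cosh t := by rw [hAt, hBt, cosh_eq]; ring
  have hsub : A - B = 2 * u * sinh t := by rw [hAt, hBt, sinh_eq]; ring
  have hlog : log A - log B = 2 * t := by
    rw [hAt, hBt, log_mul hu.ne' (exp_pos _).ne', log_mul hu.ne' (exp_pos _).ne', log_exp, log_exp]
    ring
  have hconst : s * sinh s - (1 + s * cosh s / sinh s) * cosh s = -(cosh s + s / sinh s) := by
    have := (sinh_pos_iff.2 hs).ne'
    field_simp
    linear_combination -s * cosh_sq s
  rw [hadd, hsub, hlog]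
  linear_combination (4 * u) * tangent_le_mul_sinh hs t - 4 * u * hconst

lemma two_mul_sub_mul_sqrt_le {A B δ G η q : ℝ} (hA : 0 ≤ A) (hB : 0 ≤ B) (hδ : |δ| ≤ G) :
    2 * η * (A - B) * δ + 4 * q * √(A * B) ≤ (A + B) * (1 + η ^ 2 * G ^ 2 + q ^ 2) := by
  rcases (add_nonneg hA hB).eq_or_lt' with h0 | hpos
  · obtain rfl : A = 0 := by linarith
    obtain rfl : B = 0 := by linarith
    simp
  refine le_of_mul_le_mul_left ?_ hpos
  have hr : √(A * B) ^ 2 = A * B := sq_sqrt (mul_nonneg hA hB)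
  have hδ' : δ ^ 2 ≤ G ^ 2 := sq_le_sq' (abs_le.1 hδ).1 (abs_le.1 hδ).2
  linear_combination sq_nonneg (A - B - η * δ * (A + B)) +
    sq_nonneg (2 * √(A * B) - q * (A + B)) + 4 * hr + (η * (A + B)) ^ 2 * hδ'

end HyperbolicInequalities

section Sequences

lemma hasSum_mul_sq_le {ι : Type*} {u v : ι → ℝ} {a b c : ℝ} (huv : HasSum (fun i => u i * v i) a)
    (hu : HasSum (fun i => u i ^ 2) b) (hv : HasSum (fun i => v i ^ 2) c) : a ^ 2 ≤ b * c :=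
  le_of_tendsto_of_tendsto' (Filter.Tendsto.pow huv 2) (Filter.Tendsto.mul hu hv) fun s =>
    s.sum_mul_sq_le_sq_mul_sq u v

lemma one_le_mul_zero_of_logConvex {b : ℕ → ℝ} {C t : ℝ} (hb : ∀ n, 0 ≤ b n)
    (hconv : ∀ n, b (n + 1) ^ 2 ≤ b n * b (n + 2)) (ht : 0 ≤ t)
    (hgrowth : ∀ᶠ n in Filter.atTop, b n ≤ C * t ^ n) : b 1 ≤ t * b 0 := by
  by_contra! hlt
  have hb1 : 0 < b 1 := (mul_nonneg ht (hb 0)).trans_lt hlt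
  have hb0 : 0 < b 0 := (hb 0).lt_of_ne fun h => by
    have := hconv 0
    rw [← h, zero_mul] at this
    exact (pow_pos hb1 2).not_ge this
  set r := b 1 / b 0 with hr
  have hr0 : 0 < r := div_pos hb1 hb0
  have hratio (n : ℕ) : 0 < b n ∧ r * b n ≤ b (n + 1) := by
    induction n with
    | zero => exact ⟨hb0, by rw [hr, div_mul_cancel₀ _ hb0.ne']⟩
    | succ n ih =>
      have hpos : 0 < b (n + 1) := (mul_pos hr0 ih.1).trans_le ih.2
      exact ⟨hpos, le_of_mul_le_mul_left (by nlinarith [hconv n]) ih.1⟩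
  have hpow (n : ℕ) : b 0 * r ^ n ≤ b n := by
    induction n with
    | zero => simp
    | succ n ih => exact le_trans (by rw [pow_succ]; nlinarith) (hratio n).2
  have hlim : Filter.Tendsto (fun n => C * (t / r) ^ n) Filter.atTop (nhds (C * 0)) :=
    (tendsto_pow_atTop_nhds_zero_of_lt_one (by positivity)
      (by rwa [div_lt_one hr0, lt_div_iff₀ hb0])).const_mul C
  refine hb0.not_ge ((ge_of_tendsto hlim ?_).trans_eq (mul_zero C))
  filter_upwards [hgrowth] with n hn
  rw [div_pow, ← mul_div_assoc, le_div_iff₀ (by positivity)]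
  exact (hpow n).trans hn

end Sequences

section Expectation

variable {α β : Type*}

/-- The expectation of a nonnegative function under a probability mass function. -/
def expect (p : PMF α) (F : α → ℝ≥0∞) : ℝ≥0∞ := ∑' x, p x * F x

lemma expect_mono {p : PMF α} {F G : α → ℝ≥0∞} (h : ∀ x, p x ≠ 0 → F x ≤ G x) :
    expect p F ≤ expect p G := by
  refine ENNReal.tsum_le_tsum fun x => ?_
  by_cases hx : p x = 0
  · simp [hx]
  · gcongr
    exact h x hx

lemma expect_add (p : PMF α) (F G : α → ℝ≥0∞) :
    expect p (fun x => F x + G x) = expect p F + expect p G := by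
  simp only [expect, mul_add, ENNReal.tsum_add]

lemma expect_const (p : PMF α) (c : ℝ≥0∞) : expect p (fun _ => c) = c := by
  rw [expect, ENNReal.tsum_mul_right, p.tsum_coe, one_mul]

lemma expect_bind (p : PMF α) (q : α → PMF β) (F : β → ℝ≥0∞) :
    expect (p.bind q) F = expect p fun a => expect (q a) F := by
  simp only [expect, PMF.bind_apply, ← ENNReal.tsum_mul_right, ← ENNReal.tsum_mul_left]
  rw [ENNReal.tsum_comm]
  simp only [mul_assoc]

lemma expect_pure (a : α) (F : α → ℝ≥0∞) : expect (PMF.pure a) F = F a := by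
  rw [expect, tsum_eq_single a fun b hb => by rw [PMF.pure_apply_of_ne _ _ hb, zero_mul],
    PMF.pure_apply_self, one_mul]

lemma expect_map (p : PMF α) (f : α → β) (F : β → ℝ≥0∞) :
    expect (p.map f) F = expect p fun a => F (f a) := by
  rw [← PMF.bind_pure_comp, expect_bind]
  simp only [Function.comp, expect_pure]

lemma toReal_apply_le_one (p : PMF α) (x : α) : (p x).toReal ≤ 1 :=
  ENNReal.toReal_le_of_le_ofReal zero_le_one (by simpa using p.coe_le_one x)

lemma hasSum_toReal (p : PMF α) : HasSum (fun x => (p x).toReal) 1 := by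
  have h := ENNReal.hasSum_toReal p.tsum_coe_ne_top
  rwa [← ENNReal.tsum_toReal_eq p.apply_ne_top, p.tsum_coe, ENNReal.toReal_one] at h

lemma toReal_mul_ofReal (p : PMF α) {f : α → ℝ} (hf : ∀ x, 0 ≤ f x) (x : α) :
    (p x * ENNReal.ofReal (f x)).toReal = f x * (p x).toReal := by
  rw [ENNReal.toReal_mul, ENNReal.toReal_ofReal (hf x), mul_comm]

lemma summable_iff_expect_ne_top (p : PMF α) {f : α → ℝ} (hf : ∀ x, 0 ≤ f x) :
    (Summable fun x => f x * (p x).toReal) ↔ expect p (fun x => ENNReal.ofReal (f x)) ≠ ⊤ := by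
  simp only [← toReal_mul_ofReal p hf]
  refine ⟨fun h => ?_, ENNReal.summable_toReal⟩
  simpa only [expect, ENNReal.ofReal_toReal
    (ENNReal.mul_ne_top (p.apply_ne_top _) ENNReal.ofReal_ne_top)] using h.tsum_ofReal_ne_top

lemma tsum_eq_toReal_expect (p : PMF α) {f : α → ℝ} (hf : ∀ x, 0 ≤ f x) :
    ∑' x, f x * (p x).toReal = (expect p fun x => ENNReal.ofReal (f x)).toReal := by
  simp only [← toReal_mul_ofReal p hf]
  rw [expect, ENNReal.tsum_toReal_eq fun x =>
    ENNReal.mul_ne_top (p.apply_ne_top x) ENNReal.ofReal_ne_top]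

lemma hasSum_prod_of_expect_ne_top (p : PMF α) (q : PMF β) {f : α → β → ℝ}
    (hf : ∀ x y, 0 ≤ f x y)
    (hfin : expect p (fun x => expect q fun y => ENNReal.ofReal (f x y)) ≠ ⊤) :
    HasSum (fun z : α × β => (p z.1).toReal * (q z.2).toReal * f z.1 z.2)
      (expect p (fun x => expect q fun y => ENNReal.ofReal (f x y))).toReal := by
  have hprod : expect p (fun x => expect q fun y => ENNReal.ofReal (f x y)) =
      ∑' z : α × β, p z.1 * q z.2 * ENNReal.ofReal (f z.1 z.2) := by
    rw [ENNReal.tsum_prod']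
    simp only [expect, ← ENNReal.tsum_mul_left, mul_assoc]
  rw [hprod] at hfin ⊢
  rw [ENNReal.tsum_toReal_eq fun z => ENNReal.ne_top_of_tsum_ne_top hfin z]
  simpa only [ENNReal.toReal_mul, ENNReal.toReal_ofReal (hf _ _)] using ENNReal.hasSum_toReal hfin

end Expectation

section Entropy

variable {α β : Type*}

/-- The information content `-log c` of an event of probability `c`, as an element of `[0, ∞]`;
only `c ≤ 1` is meaningful, and `c = 0` yields `0`, matching the convention `0 log 0 = 0`. -/
def surprisal (c : ℝ≥0∞) : ℝ≥0∞ := ENNReal.ofReal (-Real.log c.toReal)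

lemma surprisal_anti {a b : ℝ≥0∞} (ha : a ≠ 0) (hb : b ≠ ⊤) (h : a ≤ b) :
    surprisal b ≤ surprisal a := by
  have hpos : 0 < a.toReal := ENNReal.toReal_pos ha (ne_top_of_le_ne_top hb h)
  exact ENNReal.ofReal_le_ofReal <| neg_le_neg <|
    Real.log_le_log hpos (ENNReal.toReal_mono hb h)

lemma surprisal_mul_le {a b : ℝ≥0∞} (ha : a.toReal ≠ 0) (hb : b.toReal ≠ 0) :
    surprisal (a * b) ≤ surprisal a + surprisal b := by
  rw [surprisal, ENNReal.toReal_mul, Real.log_mul ha hb, neg_add]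
  exact ENNReal.ofReal_add_le

lemma neg_log_toReal_nonneg (p : PMF α) (x : α) : 0 ≤ -Real.log (p x).toReal :=
  neg_nonneg.2 (Real.log_nonpos ENNReal.toReal_nonneg (toReal_apply_le_one p x))

/-- The entropy of `p` as an element of `[0, ∞]`. -/
def entropyENN (p : PMF α) : ℝ≥0∞ := expect p fun x => surprisal (p x)

lemma finiteEntropy_iff (p : PMF α) : FiniteEntropy p ↔ entropyENN p ≠ ⊤ := by
  simpa only [FiniteEntropy, entropyENN, surprisal, neg_mul, mul_comm (Real.log _)] using
    summable_iff_expect_ne_top p (neg_log_toReal_nonneg p)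

lemma entropy_eq (p : PMF α) : entropy p = (entropyENN p).toReal := by
  simpa only [entropy, entropyENN, surprisal, neg_mul, mul_comm (Real.log _)] using
    tsum_eq_toReal_expect p (neg_log_toReal_nonneg p)

lemma entropyENN_pure (a : α) : entropyENN (PMF.pure a) = 0 := by
  simp [entropyENN, expect_pure, surprisal]

lemma entropyENN_bind_le (p : PMF β) (q : β → PMF α) :
    entropyENN (p.bind q) ≤ entropyENN p + expect p fun b => entropyENN (q b) := by
  rw [entropyENN, expect_bind, entropyENN, ← expect_add]
  refine expect_mono fun b hb => ?_
  rw [← expect_const (q b) (surprisal (p b)), entropyENN, ← expect_add]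
  refine expect_mono fun x hx => (surprisal_anti (mul_ne_zero hb hx) (PMF.apply_ne_top _ _)
    ?_).trans (surprisal_mul_le ?_ ?_)
  · rw [PMF.bind_apply]
    exact ENNReal.le_tsum b
  · exact ENNReal.toReal_ne_zero.2 ⟨hb, p.apply_ne_top b⟩
  · exact ENNReal.toReal_ne_zero.2 ⟨hx, (q b).apply_ne_top x⟩

lemma entropyENN_map_le (p : PMF α) (f : α → β) : entropyENN (p.map f) ≤ entropyENN p := by
  rw [entropyENN, expect_map]
  refine expect_mono fun x hx => surprisal_anti hx (PMF.apply_ne_top _ _) ?_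
  rw [PMF.map_apply]
  exact (ENNReal.le_tsum x).trans' (by simp)

end Entropy

section Convolution

variable {Γ : Type*} [Group Γ]

lemma expect_conv (p q : PMF Γ) (F : Γ → ℝ≥0∞) :
    expect (conv p q) F = expect p fun x => expect q fun y => F (x * y) := by
  simp only [conv, expect_bind, expect_map]

lemma conv_apply (p q : PMF Γ) (z : Γ) : conv p q z = ∑' x, p x * q (x⁻¹ * z) := by
  rw [conv, PMF.bind_apply]
  refine tsum_congr fun x => ?_
  rw [PMF.map_apply, tsum_eq_single (x⁻¹ * z) fun b hb => if_neg ?_, if_pos (by group)]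
  rintro rfl
  simp at hb

lemma mul_le_conv (p q : PMF Γ) (x y : Γ) : p x * q y ≤ conv p q (x * y) := by
  rw [conv_apply]
  simpa using ENNReal.le_tsum (f := fun z => p z * q (z⁻¹ * (x * y))) x

lemma conv_assoc (p q r : PMF Γ) : conv (conv p q) r = conv p (conv q r) := by
  simp only [conv, PMF.bind_bind, PMF.bind_map, PMF.map_bind, PMF.map_comp, Function.comp_def,
    mul_assoc]

lemma conv_pure_one (p : PMF Γ) : conv p (PMF.pure 1) = p := by
  simp [conv, PMF.pure_map]

lemma pure_one_conv (p : PMF Γ) : conv (PMF.pure 1) p = p := by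
  simp only [conv, PMF.pure_bind, one_mul]
  exact PMF.map_id p

lemma convPow_add (μ : PMF Γ) (m n : ℕ) :
    convPow μ (m + n) = conv (convPow μ m) (convPow μ n) := by
  induction n with
  | zero => exact (conv_pure_one _).symm
  | succ n ih => rw [← add_assoc, convPow, convPow, ih, conv_assoc]

lemma convPow_one (μ : PMF Γ) : convPow μ 1 = μ := pure_one_conv μ

lemma conv_apply_inv {p q : PMF Γ} (hp : IsSymmetric p) (hq : IsSymmetric q) (g : Γ) :
    conv p q g⁻¹ = conv q p g := by
  rw [conv_apply, conv_apply, ← (Equiv.mulLeft g⁻¹).tsum_eq]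
  refine tsum_congr fun x => ?_
  rw [Equiv.coe_mulLeft, ← hp, ← hq, mul_comm]
  congr 2 <;> group

lemma IsSymmetric.convPow {μ : PMF Γ} (hμ : IsSymmetric μ) (n : ℕ) :
    IsSymmetric (convPow μ n) := by
  induction n with
  | zero =>
    intro g
    by_cases h : g = 1 <;> simp [GroupWalk.convPow, PMF.pure_apply, h]
  | succ n ih =>
    intro g
    have hcomm : conv μ (GroupWalk.convPow μ n) = GroupWalk.convPow μ (n + 1) := by
      rw [add_comm, convPow_add, convPow_one]
    rw [← hcomm, conv_apply_inv hμ ih, hcomm, GroupWalk.convPow]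

lemma entropyENN_conv_le (p q : PMF Γ) :
    entropyENN (conv p q) ≤ entropyENN p + entropyENN q :=
  calc entropyENN (conv p q) ≤ entropyENN p + expect p fun a => entropyENN (q.map (a * ·)) :=
        entropyENN_bind_le _ _
    _ ≤ entropyENN p + expect p fun _ => entropyENN q := by
        gcongr
        exact expect_mono fun a _ => entropyENN_map_le _ _
    _ = entropyENN p + entropyENN q := by rw [expect_const]

end Convolution

section ConvSubadditive

variable {Γ : Type*} [Group Γ]

/-- Functionals of probability measures, such as the entropy and the mean length, that vanish at
`δ_e` and are subadditive under convolution, and hence grow linearly along convolution powers. -/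
structure IsConvSubadditive (Λ : PMF Γ → ℝ≥0∞) : Prop where
  map_pure_one : Λ (PMF.pure 1) = 0
  map_conv_le : ∀ p q, Λ (conv p q) ≤ Λ p + Λ q

/-- The growth rate `lim_n Λ(μ^{*n}) / n`. -/
def rate (Λ : PMF Γ → ℝ≥0∞) (μ : PMF Γ) : ℝ :=
  Filter.limUnder Filter.atTop fun n : ℕ => (Λ (convPow μ n)).toReal / n

namespace IsConvSubadditive

variable {Λ : PMF Γ → ℝ≥0∞} {μ : PMF Γ}

lemma convPow_le (hΛ : IsConvSubadditive Λ) (μ : PMF Γ) (n : ℕ) :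
    Λ (convPow μ n) ≤ n * Λ μ := by
  induction n with
  | zero => simp [convPow, hΛ.map_pure_one]
  | succ n ih =>
    rw [convPow, Nat.cast_succ, add_one_mul]
    exact (hΛ.map_conv_le _ _).trans (by gcongr)

lemma convPow_ne_top (hΛ : IsConvSubadditive Λ) (hμ : Λ μ ≠ ⊤) (n : ℕ) : Λ (convPow μ n) ≠ ⊤ :=
  ne_top_of_le_ne_top (ENNReal.mul_ne_top (ENNReal.natCast_ne_top n) hμ) (hΛ.convPow_le μ n)

lemma subadditive (hΛ : IsConvSubadditive Λ) (hμ : Λ μ ≠ ⊤) :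
    Subadditive fun n => (Λ (convPow μ n)).toReal := by
  intro m n
  have hm := hΛ.convPow_ne_top hμ m
  have hn := hΛ.convPow_ne_top hμ n
  simp only [convPow_add]
  rw [← ENNReal.toReal_add hm hn]
  exact ENNReal.toReal_mono (ENNReal.add_ne_top.2 ⟨hm, hn⟩) (hΛ.map_conv_le _ _)

lemma bddBelow_range_toReal_div (Λ : PMF Γ → ℝ≥0∞) (μ : PMF Γ) :
    BddBelow (Set.range fun n : ℕ => (Λ (convPow μ n)).toReal / n) :=
  ⟨0, by rintro _ ⟨n, rfl⟩; positivity⟩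

lemma tendsto_rate (hΛ : IsConvSubadditive Λ) (hμ : Λ μ ≠ ⊤) :
    Filter.Tendsto (fun n : ℕ => (Λ (convPow μ n)).toReal / n) Filter.atTop (nhds (rate Λ μ)) :=
  tendsto_nhds_limUnder ⟨_, (hΛ.subadditive hμ).tendsto_lim (bddBelow_range_toReal_div Λ μ)⟩

lemma rate_nonneg (hΛ : IsConvSubadditive Λ) (hμ : Λ μ ≠ ⊤) : 0 ≤ rate Λ μ :=
  ge_of_tendsto' (hΛ.tendsto_rate hμ) fun n => by positivity

lemma rate_mul_le (hΛ : IsConvSubadditive Λ) (hμ : Λ μ ≠ ⊤) (n : ℕ) :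
    rate Λ μ * n ≤ (Λ (convPow μ n)).toReal := by
  have hbdd := bddBelow_range_toReal_div Λ μ
  rcases n.eq_zero_or_pos with rfl | hn
  · simp
  rw [tendsto_nhds_unique (hΛ.tendsto_rate hμ) ((hΛ.subadditive hμ).tendsto_lim hbdd),
    ← le_div_iff₀ (by exact_mod_cast hn)]
  exact (hΛ.subadditive hμ).lim_le_div hbdd hn.ne'

lemma exists_toReal_le_add_mul (hΛ : IsConvSubadditive Λ) (hμ : Λ μ ≠ ⊤) {b : ℝ}
    (hb : rate Λ μ < b) :
    ∃ C : ℝ, 0 ≤ C ∧ ∀ n : ℕ, (Λ (convPow μ n)).toReal ≤ C + b * n := by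
  have hbdd : BddAbove (Set.range fun n : ℕ => (Λ (convPow μ n)).toReal - b * n) := by
    refine Filter.IsBoundedUnder.bddAbove_range ⟨0, Filter.eventually_map.2 ?_⟩
    filter_upwards [(hΛ.tendsto_rate hμ).eventually_lt_const hb, Filter.eventually_gt_atTop 0]
      with n hn hn0
    rw [div_lt_iff₀ (by exact_mod_cast hn0)] at hn
    linarith
  obtain ⟨C, hC⟩ := hbdd
  rw [mem_upperBounds, Set.forall_mem_range] at hC
  exact ⟨C, by simpa [convPow, hΛ.map_pure_one] using hC 0, fun n => by linarith [hC n]⟩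

end IsConvSubadditive

lemma isConvSubadditive_entropyENN : IsConvSubadditive (entropyENN (α := Γ)) :=
  ⟨entropyENN_pure 1, entropyENN_conv_le⟩

lemma rate_entropyENN (μ : PMF Γ) : rate entropyENN μ = asymptoticEntropy μ := by
  simp only [rate, asymptoticEntropy, entropy_eq]

end ConvSubadditive

section GreenMeasure

open ProbabilityTheory unitInterval

variable {p : I}

/-- The geometric distribution `n ↦ (1 - p)ⁿ p`; for `p = 0`, where these weights vanish, it is the
point mass at `0`. -/
def geom (p : I) : PMF ℕ := (geometricMeasure p).toPMF

lemma geom_apply (hp : p ≠ 0) (n : ℕ) : geom p n = ENNReal.ofReal ((1 - p) ^ n * p) := by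
  rw [geom, MeasureTheory.Measure.toPMF_apply, geometricMeasure_singleton hp]

lemma expect_geom_affine (hp : p ≠ 0) {α β : ℝ} (hα : 0 ≤ α) (hβ : 0 ≤ β) :
    expect (geom p) (fun n => ENNReal.ofReal (α + β * n)) =
      ENNReal.ofReal (α + β * ((1 - p) / p)) := by
  have hp0 : (0 : ℝ) < p := unitInterval.pos_iff_ne_zero.2 hp
  have hmean : HasSum (fun n : ℕ => (1 - p : ℝ) ^ n * p * (α + β * n)) (α + β * ((1 - p) / p)) := by
    have hcoe := hasSum_coe_mul_geometric_of_norm_lt_one (r := (1 - p : ℝ))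
      (by rw [Real.norm_eq_abs, abs_lt]; constructor <;> linarith [p.2.2])
    rw [sub_sub_cancel] at hcoe
    convert! ((hasSum_one_geometricMeasure hp).mul_right α).add (hcoe.mul_left (β * p)) using 1
    · funext n; ring
    · field_simp
  rw [expect, ← hmean.tsum_eq, ENNReal.ofReal_tsum_of_nonneg
    (fun n => mul_nonneg (geometricMeasure_nonneg p n) (by positivity)) hmean.summable]
  refine tsum_congr fun n => ?_
  rw [geom_apply hp, ← ENNReal.ofReal_mul (geometricMeasure_nonneg p n)]

lemma entropyENN_geom (hp : p ≠ 0) (hp' : p ≠ 1) :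
    entropyENN (geom p) = ENNReal.ofReal (Real.binEntropy p / p) := by
  have hp0 : (0 : ℝ) < p := unitInterval.pos_iff_ne_zero.2 hp
  have hp1 : (p : ℝ) < 1 := unitInterval.lt_one_iff_ne_one.2 hp'
  have hsurprisal (n : ℕ) : surprisal (geom p n) =
      ENNReal.ofReal (-Real.log p + -Real.log (1 - p) * n) := by
    rw [surprisal, geom_apply hp, ENNReal.toReal_ofReal (geometricMeasure_nonneg p n),
      Real.log_mul (pow_pos (sub_pos.2 hp1) n).ne' hp0.ne', Real.log_pow]
    congr 1
    ring
  simp only [entropyENN, hsurprisal]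
  rw [expect_geom_affine hp (neg_nonneg.2 (Real.log_nonpos hp0.le hp1.le))
    (neg_nonneg.2 (Real.log_nonpos (by linarith) (by linarith))), Real.binEntropy]
  congr 1
  rw [Real.log_inv, Real.log_inv]
  field_simp

variable {Γ : Type*} [Group Γ] {μ : PMF Γ}

/-- The normalized Green measure `∑ p (1 - p)ⁿ μ^{*n}`, the law of the walk at an independent
geometric time. -/
def green (μ : PMF Γ) (p : I) : PMF Γ := (geom p).bind (convPow μ)

lemma expect_green (hp : p ≠ 0) (F : Γ → ℝ≥0∞) :
    expect (green μ p) F =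
      ENNReal.ofReal p * F 1 + ENNReal.ofReal (1 - p) * expect (conv (green μ p) μ) F := by
  have hsum (G : Γ → ℝ≥0∞) : expect (green μ p) G = ∑' n, geom p n * expect (convPow μ n) G :=
    expect_bind _ _ _
  rw [expect_conv, hsum F, hsum, tsum_eq_zero_add' ENNReal.summable, ← ENNReal.tsum_mul_left]
  congr 1
  · rw [convPow, expect_pure, geom_apply hp, pow_zero, one_mul]
  · refine tsum_congr fun n => ?_
    rw [geom_apply hp, geom_apply hp, ← mul_assoc, ← ENNReal.ofReal_mul (by grind), convPow,
      expect_conv, pow_succ']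
    ring_nf

lemma green_ne_zero_iff (hp : p ≠ 0) (hp' : p ≠ 1) {x : Γ} :
    green μ p x ≠ 0 ↔ ∃ n, convPow μ n x ≠ 0 := by
  have hgeom (n : ℕ) : geom p n ≠ 0 := by
    rw [geom_apply hp]
    exact (ENNReal.ofReal_pos.2 (geometricMeasure_pos hp hp' n)).ne'
  simp [green, hgeom]

lemma green_mul_ne_zero (hp : p ≠ 0) (hp' : p ≠ 1) {x g : Γ} (hx : green μ p x ≠ 0)
    (hg : μ g ≠ 0) : green μ p (x * g) ≠ 0 := by
  obtain ⟨n, hn⟩ := (green_ne_zero_iff hp hp').1 hx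
  exact (green_ne_zero_iff hp hp').2
    ⟨n + 1, ((ENNReal.mul_pos hn hg).trans_le (mul_le_conv (convPow μ n) μ x g)).ne'⟩

lemma entropyENN_green_le (hp : p ≠ 0) (hp' : p ≠ 1) (hfin : entropyENN μ ≠ ⊤) {b C : ℝ}
    (hb : 0 ≤ b) (hC : 0 ≤ C) (hH : ∀ n : ℕ, (entropyENN (convPow μ n)).toReal ≤ C + b * n) :
    entropyENN (green μ p) ≤ ENNReal.ofReal (Real.binEntropy p / p + (C + b * ((1 - p) / p))) := by
  rw [ENNReal.ofReal_add (div_nonneg (Real.binEntropy_nonneg p.2.1 p.2.2) p.2.1)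
    (add_nonneg hC (mul_nonneg hb (div_nonneg (sub_nonneg.2 p.2.2) p.2.1))),
    ← entropyENN_geom hp hp', ← expect_geom_affine hp hC hb]
  refine (entropyENN_bind_le _ _).trans ?_
  gcongr
  refine expect_mono fun n _ => ENNReal.le_ofReal_iff_toReal_le ?_ (by positivity) |>.2 (hH n)
  exact isConvSubadditive_entropyENN.convPow_ne_top hfin n

lemma entropyENN_green_ne_top (hp : p ≠ 0) (hp' : p ≠ 1) (hfin : entropyENN μ ≠ ⊤) :
    entropyENN (green μ p) ≠ ⊤ := by
  obtain ⟨C, hC, hH⟩ := isConvSubadditive_entropyENN.exists_toReal_le_add_mul hfin (lt_add_one _)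
  have hrate := isConvSubadditive_entropyENN.rate_nonneg hfin
  exact ne_top_of_le_ne_top ENNReal.ofReal_ne_top
    (entropyENN_green_le hp hp' hfin (by positivity) hC hH)

lemma le_asymptoticEntropy_of_le_green (hfin : entropyENN μ ≠ ⊤) {c : ℝ}
    (hc : ∀ p : I, p ≠ 0 → p ≠ 1 → c ≤ p / (1 - p) * entropy (green μ p)) :
    c ≤ asymptoticEntropy μ := by
  rw [← rate_entropyENN]
  refine le_of_forall_gt_imp_ge_of_dense fun b hb => ?_
  have hb0 : 0 ≤ b := (isConvSubadditive_entropyENN.rate_nonneg hfin).trans hb.le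
  obtain ⟨C, hC, hH⟩ := isConvSubadditive_entropyENN.exists_toReal_le_add_mul hfin hb
  have hlim : Filter.Tendsto (fun a : ℝ => (Real.binEntropy a + a * C) / (1 - a) + b)
      (nhdsWithin 0 (Set.Ioi 0)) (nhds b) := by
    have hcont : ContinuousAt (fun a : ℝ => (Real.binEntropy a + a * C) / (1 - a) + b) 0 := by
      fun_prop (disch := norm_num)
    simpa using hcont.tendsto.mono_left nhdsWithin_le_nhds
  refine ge_of_tendsto hlim ?_
  filter_upwards [Ioo_mem_nhdsGT (zero_lt_one' ℝ)] with a ha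
  obtain ⟨ha0, ha1⟩ := ha
  have : 0 < 1 - a := sub_pos.2 ha1
  let p : I := ⟨a, ha0.le, ha1.le⟩
  have hp : p ≠ 0 := fun h => ha0.ne' (congrArg Subtype.val h)
  have hp' : p ≠ 1 := fun h => ha1.ne (congrArg Subtype.val h)
  have hgreen : entropy (green μ p) ≤ Real.binEntropy a / a + (C + b * ((1 - a) / a)) := by
    rw [entropy_eq]
    refine ENNReal.toReal_le_of_le_ofReal ?_ (entropyENN_green_le hp hp' hfin hb0 hC hH)
    have := Real.binEntropy_nonneg ha0.le ha1.le
    positivity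
  calc c ≤ a / (1 - a) * entropy (green μ p) := hc p hp hp'
    _ ≤ a / (1 - a) * (Real.binEntropy a / a + (C + b * ((1 - a) / a))) := by gcongr
    _ = (Real.binEntropy a + a * C) / (1 - a) + b := by field_simp; ring

end GreenMeasure

section EntropyProduction

open unitInterval

variable {Γ : Type*} [Group Γ] {μ : PMF Γ}

/-- The involution `(x, g) ↦ (x g, g⁻¹)` reversing the oriented edges `x → x g` of the Cayley
graph. -/
def reverseEdge : Γ × Γ ≃ Γ × Γ where
  toFun z := (z.1 * z.2, z.2⁻¹)
  invFun z := (z.1 * z.2, z.2⁻¹)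
  left_inv z := by simp
  right_inv z := by simp

lemma hasSum_add_reverseEdge {φ : Γ × Γ → ℝ} {S : ℝ} (h : HasSum φ S) :
    HasSum (fun z => φ z + φ (z.1 * z.2, z.2⁻¹)) (2 * S) := by
  rw [two_mul]
  exact h.add (reverseEdge.hasSum_iff.2 h)

lemma hasSum_sub_mul_sub (hμ : IsSymmetric μ) (ν : PMF Γ) {F : Γ → ℝ} (hF : ∀ x, 0 ≤ F x)
    (hν : expect ν (fun x => ENNReal.ofReal (F x)) ≠ ⊤)
    (hνμ : expect (conv ν μ) (fun x => ENNReal.ofReal (F x)) ≠ ⊤) :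
    HasSum (fun z : Γ × Γ => (μ z.2).toReal *
        (((ν z.1).toReal - (ν (z.1 * z.2)).toReal) * (F (z.1 * z.2) - F z.1)))
      (2 * ((expect (conv ν μ) fun x => ENNReal.ofReal (F x)).toReal -
        (expect ν fun x => ENNReal.ofReal (F x)).toReal)) := by
  rw [expect_conv] at hνμ ⊢
  have hend := hasSum_prod_of_expect_ne_top ν μ (f := fun x g => F (x * g)) (fun _ _ => hF _) hνμ
  have hstart := hasSum_prod_of_expect_ne_top ν μ (f := fun x _ => F x) (fun _ _ => hF _)
    (by simpa only [expect_const] using hν)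
  simp only [expect_const] at hstart
  convert! hasSum_add_reverseEdge (hend.sub hstart) using 2 with z
  simp only [hμ z.2, mul_inv_cancel_right]
  ring

lemma hasSum_green_sub_mul_sub (hμ : IsSymmetric μ) {p : I} (hp : p ≠ 0) (hp' : p ≠ 1)
    {F : Γ → ℝ} (hF : ∀ x, 0 ≤ F x)
    (hfin : expect (green μ p) (fun x => ENNReal.ofReal (F x)) ≠ ⊤) :
    HasSum (fun z : Γ × Γ => (μ z.2).toReal *
        (((green μ p z.1).toReal - (green μ p (z.1 * z.2)).toReal) * (F (z.1 * z.2) - F z.1)))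
      (2 * (p / (1 - p) * ((expect (green μ p) fun x => ENNReal.ofReal (F x)).toReal - F 1))) := by
  have hp1 : (0 : ℝ) < 1 - p := sub_pos.2 (unitInterval.lt_one_iff_ne_one.2 hp')
  have hres := expect_green hp (μ := μ) fun x => ENNReal.ofReal (F x)
  have hconv : expect (conv (green μ p) μ) (fun x => ENNReal.ofReal (F x)) ≠ ⊤ := fun htop =>
    hfin (by rw [hres, htop, ENNReal.mul_top (by simpa using hp1), add_top])
  convert hasSum_sub_mul_sub hμ (green μ p) hF hfin hconv using 2
  replace hres := congrArg ENNReal.toReal hres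
  rw [ENNReal.toReal_add (ENNReal.mul_ne_top ENNReal.ofReal_ne_top ENNReal.ofReal_ne_top)
      (ENNReal.mul_ne_top ENNReal.ofReal_ne_top hconv), ENNReal.toReal_mul, ENNReal.toReal_mul,
    ENNReal.toReal_ofReal p.2.1, ENNReal.toReal_ofReal (hF 1), ENNReal.toReal_ofReal hp1.le]
    at hres
  rw [div_mul_eq_mul_div, div_eq_iff hp1.ne']
  linear_combination hres

lemma hasSum_add_mul_weight (hμ : IsSymmetric μ) (ν : PMF Γ) {c : Γ → ℝ} (hc : ∀ g, 0 ≤ c g)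
    (hcinv : ∀ g, c g⁻¹ = c g) (hs : Summable fun g => c g * (μ g).toReal) :
    HasSum (fun z : Γ × Γ => (μ z.2).toReal *
        (((ν z.1).toReal + (ν (z.1 * z.2)).toReal) * c z.2))
      (2 * ∑' g, c g * (μ g).toReal) := by
  have hsum := hasSum_prod_of_expect_ne_top ν μ (f := fun _ g => c g) (fun _ _ => hc _)
    (by simpa only [expect_const] using (summable_iff_expect_ne_top μ hc).1 hs)
  simp only [expect_const] at hsum
  rw [tsum_eq_toReal_expect μ hc]
  convert! hasSum_add_reverseEdge hsum using 2 with z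
  simp only [hμ z.2, hcinv]
  ring

lemma hasSum_mul_add (hμ : IsSymmetric μ) (ν : PMF Γ) :
    HasSum (fun z : Γ × Γ => (μ z.2).toReal *
      ((ν z.1).toReal + (ν (z.1 * z.2)).toReal)) 2 := by
  simpa only [one_mul, mul_one, (hasSum_toReal μ).tsum_eq] using
    hasSum_add_mul_weight hμ ν (c := fun _ => 1) (fun _ => zero_le_one) (fun _ => rfl)
      (by simpa only [one_mul] using (hasSum_toReal μ).summable)

/-- The affinity `∑ μ(g) √(ν(x) ν(xg))` of the endpoints of a random edge `x → x g`, with `x`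
of law `ν` and `g` of law `μ`. -/
def affinity (μ ν : PMF Γ) : ℝ :=
  ∑' z : Γ × Γ, (μ z.2).toReal * √((ν z.1).toReal * (ν (z.1 * z.2)).toReal)

lemma summable_affinity (hμ : IsSymmetric μ) (ν : PMF Γ) :
    Summable fun z : Γ × Γ => (μ z.2).toReal * √((ν z.1).toReal * (ν (z.1 * z.2)).toReal) := by
  refine (hasSum_mul_add hμ ν).summable.of_nonneg_of_le (fun z => by positivity) fun z => ?_
  gcongr
  have hA : 0 ≤ (ν z.1).toReal := ENNReal.toReal_nonneg
  have hB : 0 ≤ (ν (z.1 * z.2)).toReal := ENNReal.toReal_nonneg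
  exact Real.sqrt_le_iff.2 ⟨by positivity, by nlinarith⟩

lemma green_eq_zero_iff (hμ : IsSymmetric μ) {p : I} (hp : p ≠ 0) (hp' : p ≠ 1) {x g : Γ}
    (hg : μ g ≠ 0) : green μ p x = 0 ↔ green μ p (x * g) = 0 := by
  refine ⟨fun hx => ?_, fun hxg => ?_⟩
  · contrapose! hx
    simpa using green_mul_ne_zero hp hp' hx (g := g⁻¹) (by rwa [hμ g])
  · contrapose! hxg
    exact green_mul_ne_zero hp hp' hxg hg

lemma sub_affinity_le_entropy_green (hμ : IsSymmetric μ) (hfin : entropyENN μ ≠ ⊤) {p : I}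
    (hp : p ≠ 0) (hp' : p ≠ 1) {s : ℝ} (hs : 0 < s) :
    2 * (1 + s * Real.cosh s / Real.sinh s) -
        2 * (Real.cosh s + s / Real.sinh s) * affinity μ (green μ p) ≤
      p / (1 - p) * entropy (green μ p) := by
  set ν := green μ p with hν
  have hproduction := hasSum_green_sub_mul_sub hμ hp hp' (neg_log_toReal_nonneg ν)
    (entropyENN_green_ne_top hp hp' hfin)
  have hlower := ((hasSum_mul_add hμ ν).mul_left (2 * (1 + s * Real.cosh s / Real.sinh s))).sub
    ((summable_affinity hμ ν).hasSum.mul_left (4 * (Real.cosh s + s / Real.sinh s)))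
  have hle := hasSum_le (fun z => ?_) hlower hproduction
  · change _ ≤ 2 * (p / (1 - p) * ((entropyENN ν).toReal - _)) at hle
    rw [← entropy_eq] at hle
    have hpos : 0 ≤ p / (1 - p) * -Real.log (ν 1).toReal :=
      mul_nonneg (div_nonneg p.2.1 (sub_nonneg.2 p.2.2)) (neg_log_toReal_nonneg ν 1)
    rw [← affinity] at hle
    linarith
  · rcases eq_or_ne (μ z.2) 0 with hg | hg
    · simp [hg]
    have hiff := green_eq_zero_iff hμ hp hp' (x := z.1) hg
    rw [← hν] at hiff
    rcases eq_or_ne (ν z.1) 0 with hx | hx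
    · simp [hx, hiff.1 hx]
    have hpoint := add_sub_sqrt_le_sub_mul_log_sub_log (s := s)
      (ENNReal.toReal_pos hx (ν.apply_ne_top _))
      (ENNReal.toReal_pos (hiff.not.1 hx) (ν.apply_ne_top _)) hs
    calc _ = (μ z.2).toReal * (2 * (1 + s * Real.cosh s / Real.sinh s) *
            ((ν z.1).toReal + (ν (z.1 * z.2)).toReal) - 4 * (Real.cosh s + s / Real.sinh s) *
            √((ν z.1).toReal * (ν (z.1 * z.2)).toReal)) := by ring
      _ ≤ _ := mul_le_mul_of_nonneg_left (hpoint.trans_eq (by ring)) ENNReal.toReal_nonneg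

lemma affinity_nonneg (μ ν : PMF Γ) : 0 ≤ affinity μ ν := tsum_nonneg fun _ => by positivity

lemma affinity_green_pos (hμ : IsSymmetric μ) {p : I} (hp : p ≠ 0) (hp' : p ≠ 1) :
    0 < affinity μ (green μ p) := by
  obtain ⟨g, hg⟩ := μ.support_nonempty
  have hone : green μ p 1 ≠ 0 := (green_ne_zero_iff hp hp').2 ⟨0, by simp [convPow]⟩
  have hg' := green_mul_ne_zero hp hp' hone hg
  refine (summable_affinity hμ _).tsum_pos (fun _ => by positivity) (1, g) ?_
  have := ENNReal.toReal_pos hone (PMF.apply_ne_top _ _)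
  have := ENNReal.toReal_pos hg' (PMF.apply_ne_top _ _)
  have := ENNReal.toReal_pos hg (PMF.apply_ne_top _ _)
  positivity

lemma mul_tanh_le_asymptoticEntropy (hμ : IsSymmetric μ) (hfin : entropyENN μ ≠ ⊤) {s : ℝ}
    (hs : 0 < s) (hQ : ∀ p : I, p ≠ 0 → p ≠ 1 → affinity μ (green μ p) ≤ 1 / Real.cosh s) :
    2 * Real.tanh s * s ≤ asymptoticEntropy μ := by
  refine le_asymptoticEntropy_of_le_green hfin fun p hp hp' => ?_
  calc 2 * Real.tanh s * s = 2 * (1 + s * Real.cosh s / Real.sinh s) -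
        2 * (Real.cosh s + s / Real.sinh s) * (1 / Real.cosh s) := by
        rw [Real.tanh_eq_sinh_div_cosh]
        field_simp
        linear_combination -s * Real.cosh_sq s
    _ ≤ 2 * (1 + s * Real.cosh s / Real.sinh s) -
        2 * (Real.cosh s + s / Real.sinh s) * affinity μ (green μ p) := by
        gcongr
        exact hQ p hp hp'
    _ ≤ p / (1 - p) * entropy (green μ p) := sub_affinity_le_entropy_green hμ hfin hp hp' hs

lemma mul_artanh_le_asymptoticEntropy (hμ : IsSymmetric μ) (hfin : entropyENN μ ≠ ⊤) {y : ℝ}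
    (hy : y ∈ Set.Ico 0 1)
    (hQ : ∀ p : I, p ≠ 0 → p ≠ 1 → y ^ 2 + affinity μ (green μ p) ^ 2 ≤ 1) :
    2 * y * Real.artanh y ≤ asymptoticEntropy μ := by
  obtain ⟨hy0, hy1⟩ := hy
  rcases hy0.eq_or_lt with rfl | hy0
  · simpa [rate_entropyENN] using isConvSubadditive_entropyENN.rate_nonneg hfin
  have hmem : y ∈ Set.Ioo (-1) 1 := ⟨by linarith, hy1⟩
  have key := mul_tanh_le_asymptoticEntropy hμ hfin (Real.artanh_pos ⟨hy0, hy1⟩) fun p hp hp' => by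
    rw [Real.cosh_artanh hmem, one_div_one_div]
    exact Real.le_sqrt_of_sq_le (by linarith [hQ p hp hp'])
  rwa [Real.tanh_artanh hmem] at key

end EntropyProduction

section SpectralRadius

variable {Γ : Type*} [Group Γ] {μ : PMF Γ}

lemma hasSum_convPow_mul (hμ : IsSymmetric μ) (m n : ℕ) (x y : Γ) :
    HasSum (fun z => (convPow μ m (x⁻¹ * z)).toReal * (convPow μ n (y⁻¹ * z)).toReal)
      (convPow μ (m + n) (x⁻¹ * y)).toReal := by
  have hconv : convPow μ (m + n) (x⁻¹ * y) =
      ∑' z, convPow μ m (x⁻¹ * z) * convPow μ n (y⁻¹ * z) := by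
    rw [convPow_add, conv_apply, ← (Equiv.mulLeft x⁻¹).tsum_eq]
    refine tsum_congr fun z => ?_
    rw [Equiv.coe_mulLeft, ← (hμ.convPow n) (y⁻¹ * z)]
    congr 2
    group
  have hfin : ∑' z, convPow μ m (x⁻¹ * z) * convPow μ n (y⁻¹ * z) ≠ ⊤ :=
    hconv ▸ PMF.apply_ne_top _ _
  simp only [← ENNReal.toReal_mul]
  rw [hconv, ENNReal.tsum_toReal_eq fun z => ENNReal.ne_top_of_tsum_ne_top hfin z]
  exact ENNReal.hasSum_toReal hfin

lemma convPow_even_le (hμ : IsSymmetric μ) (n : ℕ) (g : Γ) :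
    (convPow μ (n + n) g).toReal ≤ (convPow μ (n + n) 1).toReal := by
  have h11 := hasSum_convPow_mul hμ n n 1 1
  have hgg := hasSum_convPow_mul hμ n n g g
  have h1g := hasSum_convPow_mul hμ n n 1 g
  have hsq := ((h11.add hgg).sub (h1g.mul_left 2)).nonneg fun z => by
    nlinarith [sq_nonneg ((convPow μ n (1⁻¹ * z)).toReal - (convPow μ n (g⁻¹ * z)).toReal)]
  simp only [inv_one, one_mul, inv_mul_cancel] at hsq
  linarith

/-- The quadratic form `⟨f, Pⁿ f⟩` of the Markov operator `P` of the walk on `ℓ²(Γ)`, for `f`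
restricted to the finite set `S`. -/
def quadForm (μ : PMF Γ) (S : Finset Γ) (f : Γ → ℝ) (n : ℕ) : ℝ :=
  ∑ x ∈ S, ∑ y ∈ S, f x * f y * (convPow μ n (x⁻¹ * y)).toReal

lemma hasSum_quadForm (hμ : IsSymmetric μ) (S : Finset Γ) (f : Γ → ℝ) (m n : ℕ) :
    HasSum (fun z => (∑ x ∈ S, f x * (convPow μ m (x⁻¹ * z)).toReal) *
      ∑ y ∈ S, f y * (convPow μ n (y⁻¹ * z)).toReal) (quadForm μ S f (m + n)) := by
  simp only [Finset.sum_mul_sum, mul_mul_mul_comm (f _)]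
  exact hasSum_sum fun x _ => hasSum_sum fun y _ => (hasSum_convPow_mul hμ m n x y).mul_left _

lemma quadForm_even_nonneg (hμ : IsSymmetric μ) (S : Finset Γ) (f : Γ → ℝ) (n : ℕ) :
    0 ≤ quadForm μ S f (n + n) :=
  (hasSum_quadForm hμ S f n n).nonneg fun _ => mul_self_nonneg _

lemma quadForm_sq_le (hμ : IsSymmetric μ) (S : Finset Γ) (f : Γ → ℝ) (m n : ℕ) :
    quadForm μ S f (m + n) ^ 2 ≤ quadForm μ S f (m + m) * quadForm μ S f (n + n) :=
  hasSum_mul_sq_le (hasSum_quadForm hμ S f m n)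
    (by simpa only [sq] using hasSum_quadForm hμ S f m m)
    (by simpa only [sq] using hasSum_quadForm hμ S f n n)

lemma quadForm_zero (μ : PMF Γ) (S : Finset Γ) (f : Γ → ℝ) :
    quadForm μ S f 0 = ∑ x ∈ S, f x ^ 2 := by
  refine Finset.sum_congr rfl fun x hx => ?_
  rw [Finset.sum_eq_single_of_mem x hx fun y _ hy => ?_]
  · simp [convPow, sq]
  · rw [convPow, PMF.pure_apply_of_ne _ _ (by rwa [Ne, inv_mul_eq_one, eq_comm]),
      ENNReal.toReal_zero, mul_zero]

lemma quadForm_even_le (hμ : IsSymmetric μ) (S : Finset Γ) (f : Γ → ℝ) (n : ℕ) :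
    quadForm μ S f (n + n) ≤ (∑ x ∈ S, |f x|) ^ 2 * (convPow μ (n + n) 1).toReal := by
  rw [sq, Finset.sum_mul_sum, Finset.sum_mul]
  refine Finset.sum_le_sum fun x _ => ?_
  rw [Finset.sum_mul]
  refine Finset.sum_le_sum fun y _ => ?_
  rw [← abs_mul]
  exact mul_le_mul (le_abs_self _) (convPow_even_le hμ n _) ENNReal.toReal_nonneg (abs_nonneg _)

lemma rpow_return_le_one (μ : PMF Γ) (n : ℕ) :
    (convPow μ n 1).toReal ^ (1 / (n : ℝ)) ≤ 1 :=
  Real.rpow_le_one ENNReal.toReal_nonneg (toReal_apply_le_one _ _) (by positivity)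

lemma isBoundedUnder_rpow_return (μ : PMF Γ) : Filter.IsBoundedUnder (· ≤ ·) Filter.atTop
    fun n : ℕ => (convPow μ n 1).toReal ^ (1 / (n : ℝ)) :=
  Filter.isBoundedUnder_of ⟨1, rpow_return_le_one μ⟩

lemma spectralRad_le_one (μ : PMF Γ) : spectralRad μ ≤ 1 :=
  Filter.limsup_le_of_le
    (Filter.isBoundedUnder_of ⟨0, fun _ => by positivity⟩).isCoboundedUnder_le
    (Filter.Eventually.of_forall (rpow_return_le_one μ))

lemma spectralRad_nonneg (μ : PMF Γ) : 0 ≤ spectralRad μ :=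
  Filter.le_limsup_of_frequently_le (Filter.Frequently.of_forall fun _ => by positivity)
    (isBoundedUnder_rpow_return μ)

lemma eventually_return_le {t : ℝ} (ht : spectralRad μ < t) :
    ∀ᶠ n : ℕ in Filter.atTop, (convPow μ n 1).toReal ≤ t ^ n := by
  filter_upwards [Filter.eventually_lt_of_limsup_lt ht (isBoundedUnder_rpow_return μ),
    Filter.eventually_ne_atTop 0] with n hn hn0
  rw [← Real.rpow_inv_natCast_pow (ENNReal.toReal_nonneg (a := convPow μ n 1)) hn0, ← one_div]
  gcongr

/-- The sequence `⟨f, P²ⁿ f⟩` is log-convex and grows at most like `t²ⁿ` for every `t > ρ`. -/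
lemma quadForm_two_le (hμ : IsSymmetric μ) (S : Finset Γ) (f : Γ → ℝ) :
    quadForm μ S f 2 ≤ spectralRad μ ^ 2 * quadForm μ S f 0 := by
  have hle (t : ℝ) (ht : spectralRad μ < t) : quadForm μ S f 2 ≤ t ^ 2 * quadForm μ S f 0 := by
    refine one_le_mul_zero_of_logConvex (b := fun n => quadForm μ S f (n + n))
      (C := (∑ x ∈ S, |f x|) ^ 2) (quadForm_even_nonneg hμ S f) (fun n => ?_) (sq_nonneg t) ?_
    · have h := quadForm_sq_le hμ S f n (n + 2)
      rwa [show n + (n + 2) = n + 1 + (n + 1) by ring] at h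
    · have htwice : Filter.Tendsto (fun n : ℕ => n + n) Filter.atTop Filter.atTop :=
        Filter.tendsto_atTop_mono (fun n => n.le_add_left n) Filter.tendsto_id
      filter_upwards [htwice.eventually (eventually_return_le ht)] with n hn
      rw [← pow_mul, two_mul]
      exact (quadForm_even_le hμ S f n).trans (by gcongr)
  have hcont : Continuous fun t : ℝ => t ^ 2 * quadForm μ S f 0 := by fun_prop
  refine ge_of_tendsto (hcont.continuousWithinAt (s := Set.Ioi (spectralRad μ))) ?_
  filter_upwards [self_mem_nhdsWithin] with t ht using hle t ht

lemma quadForm_one_le (hμ : IsSymmetric μ) (S : Finset Γ) (f : Γ → ℝ) :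
    quadForm μ S f 1 ≤ spectralRad μ * quadForm μ S f 0 := by
  have h0 : 0 ≤ quadForm μ S f 0 := quadForm_even_nonneg hμ S f 0
  refine le_of_sq_le_sq ?_ (mul_nonneg (spectralRad_nonneg μ) h0)
  calc quadForm μ S f 1 ^ 2 ≤ quadForm μ S f 0 * quadForm μ S f 2 := quadForm_sq_le hμ S f 0 1
    _ ≤ quadForm μ S f 0 * (spectralRad μ ^ 2 * quadForm μ S f 0) := by
      gcongr
      exact quadForm_two_le hμ S f
    _ = (spectralRad μ * quadForm μ S f 0) ^ 2 := by ring

lemma spectralRad_pos (hμ : IsSymmetric μ) : 0 < spectralRad μ := by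
  obtain ⟨g, hg⟩ := μ.support_nonempty
  have hreturn : convPow μ 2 1 ≠ 0 := by
    have hle := mul_le_conv (convPow μ 1) μ g g⁻¹
    rw [convPow_one, hμ, mul_inv_cancel] at hle
    rw [convPow, convPow_one]
    exact ((ENNReal.mul_pos hg hg).trans_le hle).ne'
  have hle : (convPow μ 2 1).toReal ≤ spectralRad μ ^ 2 := by
    simpa [quadForm, convPow] using quadForm_two_le hμ {1} fun _ => 1
  exact (spectralRad_nonneg μ).lt_of_ne' (sq_pos_iff.1
    ((ENNReal.toReal_pos hreturn (PMF.apply_ne_top _ _)).trans_le hle))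

lemma sum_sqrt_le_quadForm (μ ν : PMF Γ) (s : Finset (Γ × Γ)) : ∃ S : Finset Γ,
    ∑ z ∈ s, (μ z.2).toReal * √((ν z.1).toReal * (ν (z.1 * z.2)).toReal) ≤
      quadForm μ S (fun x => √(ν x).toReal) 1 := by
  classical
  let endpoints : Γ × Γ ≃ Γ × Γ := Equiv.prodShear (.refl Γ) Equiv.mulLeft
  set E := s.map endpoints.toEmbedding
  refine ⟨E.image Prod.fst ∪ E.image Prod.snd, ?_⟩
  have hsub : E ⊆ (E.image Prod.fst ∪ E.image Prod.snd) ×ˢ (E.image Prod.fst ∪ E.image Prod.snd) :=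
    Finset.subset_product.trans
      (Finset.product_subset_product Finset.subset_union_left Finset.subset_union_right)
  rw [quadForm, ← Finset.sum_product']
  refine le_trans (le_of_eq ?_)
    (Finset.sum_le_sum_of_subset_of_nonneg hsub fun w _ _ => by positivity)
  rw [Finset.sum_map]
  refine Finset.sum_congr rfl fun z _ => ?_
  simp [endpoints, convPow_one, mul_comm]

lemma quadForm_zero_sqrt_le_one (μ ν : PMF Γ) (S : Finset Γ) :
    quadForm μ S (fun x => √(ν x).toReal) 0 ≤ 1 := by
  simp only [quadForm_zero, Real.sq_sqrt ENNReal.toReal_nonneg]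
  exact sum_le_hasSum S (fun _ _ => ENNReal.toReal_nonneg) (hasSum_toReal ν)

lemma affinity_le_spectralRad (hμ : IsSymmetric μ) (ν : PMF Γ) :
    affinity μ ν ≤ spectralRad μ := by
  refine (summable_affinity hμ ν).tsum_le_of_sum_le fun s => ?_
  obtain ⟨S, hS⟩ := sum_sqrt_le_quadForm μ ν s
  calc _ ≤ quadForm μ S (fun x => √(ν x).toReal) 1 := hS
    _ ≤ spectralRad μ * quadForm μ S (fun x => √(ν x).toReal) 0 := quadForm_one_le hμ S _
    _ ≤ spectralRad μ :=
      mul_le_of_le_one_right (spectralRad_nonneg μ) (quadForm_zero_sqrt_le_one μ ν S)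

lemma sqrt_mul_artanh_le_asymptoticEntropy (hμ : IsSymmetric μ) (hfin : entropyENN μ ≠ ⊤) :
    2 * √(1 - spectralRad μ ^ 2) * Real.artanh √(1 - spectralRad μ ^ 2) ≤
      asymptoticEntropy μ := by
  have hρ := spectralRad_pos hμ
  have hlt : √(1 - spectralRad μ ^ 2) < 1 := (Real.sqrt_lt' one_pos).2 (by nlinarith)
  refine mul_artanh_le_asymptoticEntropy hμ hfin ⟨Real.sqrt_nonneg _, hlt⟩ fun p _ _ => ?_
  have haff : affinity μ (green μ p) ^ 2 ≤ spectralRad μ ^ 2 :=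
    pow_le_pow_left₀ (affinity_nonneg _ _) (affinity_le_spectralRad hμ _) 2
  rw [Real.sq_sqrt (by nlinarith [spectralRad_le_one μ])]
  linarith

end SpectralRadius

section Drift

open unitInterval

variable {Γ : Type*} [Group Γ] [MetricSpace Γ] {μ : PMF Γ}

lemma len_nonneg (g : Γ) : 0 ≤ len g := dist_nonneg

lemma len_one : len (1 : Γ) = 0 := dist_self 1

lemma len_inv (hinv : LeftInvariantDist Γ) (g : Γ) : len g⁻¹ = len g := by
  rw [len, len, ← hinv g, mul_inv_cancel, mul_one, dist_comm]

lemma abs_len_mul_sub_le (hinv : LeftInvariantDist Γ) (x g : Γ) :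
    |len (x * g) - len x| ≤ len g := by
  simpa only [len, ← hinv x g 1, mul_one] using abs_dist_sub_le (x * g) x 1

lemma len_mul_le (hinv : LeftInvariantDist Γ) (x y : Γ) : len (x * y) ≤ len x + len y := by
  linarith [(abs_le.1 (abs_len_mul_sub_le hinv x y)).2]

/-- The mean length of `p` as an element of `[0, ∞]`. -/
def lengthENN (p : PMF Γ) : ℝ≥0∞ := expect p fun g => ENNReal.ofReal (len g)

lemma finiteFirstMoment_iff (p : PMF Γ) : FiniteFirstMoment p ↔ lengthENN p ≠ ⊤ :=
  summable_iff_expect_ne_top p len_nonneg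

lemma meanLength_eq (p : PMF Γ) : meanLength p = (lengthENN p).toReal :=
  tsum_eq_toReal_expect p len_nonneg

lemma FiniteSecondMoment.finiteFirstMoment {p : PMF Γ} (h : FiniteSecondMoment p) :
    FiniteFirstMoment p := by
  refine ((hasSum_toReal p).summable.add h).of_nonneg_of_le
    (fun g => mul_nonneg (len_nonneg g) ENNReal.toReal_nonneg) fun g => ?_
  rw [← one_add_mul]
  gcongr
  nlinarith [sq_nonneg (len g - 1)]

lemma lengthENN_conv_le (hinv : LeftInvariantDist Γ) (p q : PMF Γ) :
    lengthENN (conv p q) ≤ lengthENN p + lengthENN q := by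
  rw [lengthENN, expect_conv, ← expect_const p (lengthENN q), lengthENN, ← expect_add]
  refine expect_mono fun x _ => ?_
  rw [← expect_const q (ENNReal.ofReal (len x)), lengthENN, ← expect_add]
  refine expect_mono fun y _ => ?_
  rw [← ENNReal.ofReal_add (len_nonneg x) (len_nonneg y)]
  exact ENNReal.ofReal_le_ofReal (len_mul_le hinv x y)

lemma isConvSubadditive_lengthENN (hinv : LeftInvariantDist Γ) :
    IsConvSubadditive (lengthENN (Γ := Γ)) where
  map_pure_one := by rw [lengthENN, expect_pure, len_one, ENNReal.ofReal_zero]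
  map_conv_le := lengthENN_conv_le hinv

lemma rate_lengthENN (μ : PMF Γ) : rate lengthENN μ = drift μ := by
  simp only [rate, drift, meanLength_eq]

lemma lengthENN_green (μ : PMF Γ) (p : I) :
    lengthENN (green μ p) = expect (geom p) fun n => lengthENN (convPow μ n) := expect_bind _ _ _

lemma lengthENN_green_ne_top (hinv : LeftInvariantDist Γ) (hfin : lengthENN μ ≠ ⊤) {p : I}
    (hp : p ≠ 0) : lengthENN (green μ p) ≠ ⊤ := by
  refine ne_top_of_le_ne_top ENNReal.ofReal_ne_top
    (le_of_le_of_eq ?_ (expect_geom_affine hp le_rfl (ENNReal.toReal_nonneg (a := lengthENN μ))))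
  rw [lengthENN_green]
  refine expect_mono fun n _ =>
    ((isConvSubadditive_lengthENN hinv).convPow_le μ n).trans_eq ?_
  rw [zero_add, ENNReal.ofReal_mul ENNReal.toReal_nonneg, ENNReal.ofReal_toReal hfin,
    ENNReal.ofReal_natCast, mul_comm]

lemma drift_le_lengthENN_green (hinv : LeftInvariantDist Γ) (hfin : lengthENN μ ≠ ⊤) {p : I}
    (hp : p ≠ 0) (hp' : p ≠ 1) :
    drift μ ≤ p / (1 - p) * (lengthENN (green μ p)).toReal := by
  have hΛ := isConvSubadditive_lengthENN hinv
  have hp0 : (0 : ℝ) < p := unitInterval.pos_iff_ne_zero.2 hp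
  have hp1 : (0 : ℝ) < 1 - p := sub_pos.2 (unitInterval.lt_one_iff_ne_one.2 hp')
  rw [← rate_lengthENN]
  have hle : ENNReal.ofReal (0 + rate lengthENN μ * ((1 - p) / p)) ≤ lengthENN (green μ p) := by
    rw [← expect_geom_affine hp le_rfl (hΛ.rate_nonneg hfin), lengthENN_green]
    refine expect_mono fun n _ => ?_
    rw [zero_add, ENNReal.ofReal_le_iff_le_toReal (hΛ.convPow_ne_top hfin n)]
    exact hΛ.rate_mul_le hfin n
  rw [zero_add, ENNReal.ofReal_le_iff_le_toReal (lengthENN_green_ne_top hinv hfin hp)] at hle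
  calc rate lengthENN μ = p / (1 - p) * (rate lengthENN μ * ((1 - p) / p)) := by field_simp
    _ ≤ p / (1 - p) * (lengthENN (green μ p)).toReal := by gcongr

lemma M2_sq (μ : PMF Γ) : M2 μ ^ 2 = ∑' g, len g ^ 2 * (μ g).toReal :=
  Real.sq_sqrt (tsum_nonneg fun _ => by positivity)

lemma drift_add_affinity_le (hinv : LeftInvariantDist Γ) (hμ : IsSymmetric μ)
    (h2 : FiniteSecondMoment μ) {p : I} (hp : p ≠ 0) (hp' : p ≠ 1) {η : ℝ} (hη : 0 ≤ η) (q : ℝ) :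
    2 * η * drift μ + 2 * q * affinity μ (green μ p) ≤ 1 + (η * M2 μ) ^ 2 + q ^ 2 := by
  have hfin := (finiteFirstMoment_iff μ).1 h2.finiteFirstMoment
  set ν := green μ p with hν
  have hlength : HasSum (fun z : Γ × Γ => (μ z.2).toReal *
      (((ν z.1).toReal - (ν (z.1 * z.2)).toReal) * (len (z.1 * z.2) - len z.1)))
      (2 * (p / (1 - p) * (lengthENN ν).toReal)) := by
    simpa only [len_one, sub_zero, lengthENN] using hasSum_green_sub_mul_sub hμ hp hp' len_nonneg
      (lengthENN_green_ne_top hinv hfin hp)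
  have hlengthSq : HasSum (fun z : Γ × Γ => (μ z.2).toReal *
      (((ν z.1).toReal + (ν (z.1 * z.2)).toReal) * len z.2 ^ 2)) (2 * M2 μ ^ 2) := by
    rw [M2_sq]
    exact hasSum_add_mul_weight hμ ν (fun g => sq_nonneg (len g)) (fun g => by rw [len_inv hinv]) h2
  have hle := hasSum_le (fun z => ?_)
    ((hlength.mul_left (2 * η)).add ((summable_affinity hμ ν).hasSum.mul_left (4 * q)))
    (((hasSum_mul_add hμ ν).mul_left (1 + q ^ 2)).add (hlengthSq.mul_left (η ^ 2)))
  · rw [← affinity] at hle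
    have hdrift := mul_le_mul_of_nonneg_left (drift_le_lengthENN_green hinv hfin hp hp') hη
    rw [← hν] at hdrift
    linarith
  · have hpoint := two_mul_sub_mul_sqrt_le (A := (ν z.1).toReal) (B := (ν (z.1 * z.2)).toReal)
      (η := η) (q := q) ENNReal.toReal_nonneg ENNReal.toReal_nonneg
      (abs_len_mul_sub_le hinv z.1 z.2)
    calc _ = (μ z.2).toReal * (2 * η * ((ν z.1).toReal - (ν (z.1 * z.2)).toReal) *
            (len (z.1 * z.2) - len z.1) + 4 * q * √((ν z.1).toReal * (ν (z.1 * z.2)).toReal)) := by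
          ring
      _ ≤ (μ z.2).toReal * (((ν z.1).toReal + (ν (z.1 * z.2)).toReal) *
            (1 + η ^ 2 * len z.2 ^ 2 + q ^ 2)) := by gcongr
      _ = _ := by ring

lemma normDrift_nonneg (hinv : LeftInvariantDist Γ) (hfin : lengthENN μ ≠ ⊤) :
    0 ≤ normDrift μ := by
  rw [normDrift, ← rate_lengthENN]
  exact div_nonneg ((isConvSubadditive_lengthENN hinv).rate_nonneg hfin) (Real.sqrt_nonneg _)

lemma normDrift_sq_add_affinity_sq_le_one (hinv : LeftInvariantDist Γ) (hμ : IsSymmetric μ)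
    (h2 : FiniteSecondMoment μ) {p : I} (hp : p ≠ 0) (hp' : p ≠ 1) :
    normDrift μ ^ 2 + affinity μ (green μ p) ^ 2 ≤ 1 := by
  have hℓ := normDrift_nonneg hinv ((finiteFirstMoment_iff μ).1 h2.finiteFirstMoment)
  have hM : 0 ≤ M2 μ := Real.sqrt_nonneg _
  have hle := drift_add_affinity_le hinv hμ h2 hp hp' (div_nonneg hℓ hM)
    (affinity μ (green μ p))
  have hdrift : normDrift μ / M2 μ * drift μ = normDrift μ ^ 2 := by
    rw [normDrift]
    ring
  have hcancel : normDrift μ / M2 μ * M2 μ = normDrift μ :=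
    div_mul_cancel_of_imp fun hM0 => by rw [normDrift, hM0, div_zero]
  rw [hcancel, mul_assoc, hdrift] at hle
  linarith

lemma normDrift_lt_one (hinv : LeftInvariantDist Γ) (hμ : IsSymmetric μ)
    (h2 : FiniteSecondMoment μ) : normDrift μ < 1 := by
  let p : I := ⟨1 / 2, by norm_num, by norm_num⟩
  have hp : p ≠ 0 := Subtype.coe_ne_coe.1 (by norm_num [p])
  have hp' : p ≠ 1 := Subtype.coe_ne_coe.1 (by norm_num [p])
  have := affinity_green_pos hμ hp hp'
  nlinarith [normDrift_sq_add_affinity_sq_le_one hinv hμ h2 hp hp']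

end Drift

end GroupWalk

end

open GroupWalk in
theorem theorem1p2_general {Γ : Type*} [Group Γ] [MetricSpace Γ] (hinv : LeftInvariantDist Γ)
    (μ : PMF Γ) (hsymm : IsSymmetric μ) (hent : FiniteEntropy μ) :
    ((∀ n : ℕ, FiniteEntropy (convPow μ n)) ∧
      Filter.Tendsto (fun n : ℕ => entropy (convPow μ n) / n) Filter.atTop
        (nhds (asymptoticEntropy μ))) ∧
    (0 < spectralRad μ ∧ spectralRad μ ≤ 1 ∧
      2 * √(1 - spectralRad μ ^ 2) * Real.artanh √(1 - spectralRad μ ^ 2) ≤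
        asymptoticEntropy μ) ∧
    (FiniteSecondMoment μ →
      ((∀ n : ℕ, FiniteFirstMoment (convPow μ n)) ∧
        Filter.Tendsto (fun n : ℕ => meanLength (convPow μ n) / n) Filter.atTop
          (nhds (drift μ))) ∧
      0 ≤ normDrift μ ∧ normDrift μ < 1 ∧
      2 * normDrift μ * Real.artanh (normDrift μ) ≤ asymptoticEntropy μ) := by
  have hfin : entropyENN μ ≠ ⊤ := (finiteEntropy_iff μ).1 hent
  have hH := isConvSubadditive_entropyENN (Γ := Γ)
  refine ⟨⟨fun n => (finiteEntropy_iff _).2 (hH.convPow_ne_top hfin n), ?_⟩,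
    ⟨spectralRad_pos hsymm, spectralRad_le_one μ, sqrt_mul_artanh_le_asymptoticEntropy hsymm hfin⟩,
    fun h2 => ?_⟩
  · simpa only [entropy_eq, rate_entropyENN] using hH.tendsto_rate hfin
  · have hlen : lengthENN μ ≠ ⊤ := (finiteFirstMoment_iff μ).1 h2.finiteFirstMoment
    have hΛ := isConvSubadditive_lengthENN hinv
    have hnonneg : 0 ≤ normDrift μ := normDrift_nonneg hinv hlen
    have hlt : normDrift μ < 1 := normDrift_lt_one hinv hsymm h2
    refine ⟨⟨fun n => (finiteFirstMoment_iff _).2 (hΛ.convPow_ne_top hlen n), ?_⟩, hnonneg, hlt,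
      mul_artanh_le_asymptoticEntropy hsymm hfin ⟨hnonneg, hlt⟩ fun p hp hp' =>
        normDrift_sq_add_affinity_sq_le_one hinv hsymm h2 hp hp'⟩
    simpa only [meanLength_eq, rate_lengthENN] using hΛ.tendsto_rate hlen

theorem theorem1p2 {Γ : Type*} [Group Γ] [Countable Γ] [MetricSpace Γ]
    (hinv : GroupWalk.LeftInvariantDist Γ) (hproper : GroupWalk.ProperDist Γ)
    (μ : PMF Γ) (hsymm : GroupWalk.IsSymmetric μ) (hent : GroupWalk.FiniteEntropy μ) :
    -- the asymptotic entropy is well defined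
    ((∀ n : ℕ, GroupWalk.FiniteEntropy (GroupWalk.convPow μ n)) ∧
      Filter.Tendsto (fun n : ℕ => GroupWalk.entropy (GroupWalk.convPow μ n) / n) Filter.atTop
        (nhds (GroupWalk.asymptoticEntropy μ))) ∧
    -- the inequality for the spectral radius, where `√(1 - ρ²)` lies in `[0, 1)`
    (0 < GroupWalk.spectralRad μ ∧ GroupWalk.spectralRad μ ≤ 1 ∧
      2 * Real.sqrt (1 - GroupWalk.spectralRad μ ^ 2) *
          Real.artanh (Real.sqrt (1 - GroupWalk.spectralRad μ ^ 2)) ≤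
        GroupWalk.asymptoticEntropy μ) ∧
    -- the drift is well defined and satisfies the inequality, where `ℓ / M₂(μ)` lies in `[0, 1)`
    (GroupWalk.FiniteSecondMoment μ →
      ((∀ n : ℕ, GroupWalk.FiniteFirstMoment (GroupWalk.convPow μ n)) ∧
        Filter.Tendsto (fun n : ℕ => GroupWalk.meanLength (GroupWalk.convPow μ n) / n)
          Filter.atTop (nhds (GroupWalk.drift μ))) ∧
      0 ≤ GroupWalk.normDrift μ ∧ GroupWalk.normDrift μ < 1 ∧
      2 * GroupWalk.normDrift μ * Real.artanh (GroupWalk.normDrift μ) ≤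
        GroupWalk.asymptoticEntropy μ) :=
  theorem1p2_general hinv μ hsymm hent
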